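/- All trees are finite, rooted and binary: every node may have a left child and a right child, though one or both of them may be missing. Let $\Sigma$ be a finite alphabet. A $\Sigma$-labelled binary tree $T$, in which every node carries exactly one label from $\Sigma$, is regarded as a relational structure whose domain is the set $V(T)$ of nodes, with two binary relations (being the left child, being the right child) and one unary predicate for each label $a\in\Sigma$. $\mathsf{CMSO}$ is monadic second-order logic (first-order logic together with quantification over sets of elements of the domain) extended by the modular predicates $|Z|\equiv a \bmod p$, where $Z$ is a set variable and $a,p$ are integers. A partitioned $\mathsf{CMSO}$-formula $\varphi(\bar x,\bar y)$ is a $\mathsf{CMSO}$-formula whose free variables are element variables, partitioned into two finite tuples, the object variables $\bar x$ and the parameter variables $\bar y$. For a tree $T$ and a set $A\subseteq V(T)$, write $V(T)^{\bar x}$, $V(T)^{\bar y}$ and $A^{\bar x}$ for the sets of evaluations of these variables in $V(T)$ or in $A$, and let $$S^{\varphi}(T)[A]=\bigl\{\,\{\bar u\in A^{\bar x} : T\models\varphi(\bar u,\bar v)\} \;:\; \bar v\in V(T)^{\bar y}\bigr\}.$$ **Theorem.** Let $\mathcal C$ be a class of finite binary trees with labels from a finite alphabet $\Sigma$, and let $\varphi(\bar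 x,\bar y)$ be a partitioned $\mathsf{CMSO}$-formula over the signature of $\Sigma$-labelled binary trees. Then there is a constant $c\in\mathbb N$ such that for every tree $T\in\mathcal C$ and every non-empty set $A$ of nodes of $T$, $$|S^{\varphi}(T)[A]|\le c\cdot |A|^{|\bar y|}.$$ -/

import Mathlib

universe u v w u' v' w'

/-! ### Finite labelled binary trees as relational structures -/

namespace LabelledTree

/-- The nodes of a finite rooted binary tree whose nodes carry labels from `Λ`. Every node may have
a left child and a right child, and one or both may be missing; `BinaryTree.nil` stands for a
missing subtree and contributes no node. -/
inductive Node {Λ : Type u} : BinaryTree Λ → Type u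
  | root (a : Λ) (l r : BinaryTree Λ) : Node (.node a l r)
  | inLeft (a : Λ) {l : BinaryTree Λ} (r : BinaryTree Λ) (t : Node l) : Node (.node a l r)
  | inRight (a : Λ) (l : BinaryTree Λ) {r : BinaryTree Λ} (t : Node r) : Node (.node a l r)

/-- The label of a node. -/
def Node.label {Λ : Type u} : {T : BinaryTree Λ} → Node T → Λ
  | _, .root a _ _ => a
  | _, .inLeft _ _ t => t.label
  | _, .inRight _ _ t => t.label

/-- `IsLeftChild s t`: the node `t` is the left child of the node `s`. -/
inductive IsLeftChild {Λ : Type u} : {T : BinaryTree Λ} → Node T → Node T → Prop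
  | root (a b : Λ) (l l' r : BinaryTree Λ) :
      IsLeftChild (.root a (.node b l l') r) (.inLeft a r (.root b l l'))
  | inLeft (a : Λ) {l : BinaryTree Λ} (r : BinaryTree Λ) {s t : Node l} (h : IsLeftChild s t) :
      IsLeftChild (.inLeft a r s) (.inLeft a r t)
  | inRight (a : Λ) (l : BinaryTree Λ) {r : BinaryTree Λ} {s t : Node r} (h : IsLeftChild s t) :
      IsLeftChild (.inRight a l s) (.inRight a l t)

/-- `IsRightChild s t`: the node `t` is the right child of the node `s`. -/
inductive IsRightChild {Λ : Type u} : {T : BinaryTree Λ} → Node T → Node T → Prop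
  | root (a b : Λ) (l r r' : BinaryTree Λ) :
      IsRightChild (.root a l (.node b r r')) (.inRight a l (.root b r r'))
  | inLeft (a : Λ) {l : BinaryTree Λ} (r : BinaryTree Λ) {s t : Node l} (h : IsRightChild s t) :
      IsRightChild (.inLeft a r s) (.inLeft a r t)
  | inRight (a : Λ) (l : BinaryTree Λ) {r : BinaryTree Λ} {s t : Node r} (h : IsRightChild s t) :
      IsRightChild (.inRight a l s) (.inRight a l t)

/-- The relation symbols of the signature of `Λ`-labelled binary trees: two binary symbols for the
left and the right successor, and one unary symbol for each label. -/
inductive TreeRel (Λ : Type u) : ℕ → Type u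
  | left : TreeRel Λ 2
  | right : TreeRel Λ 2
  | label (a : Λ) : TreeRel Λ 1

/-- The relational signature of `Λ`-labelled binary trees. -/
def treeLanguage (Λ : Type u) : FirstOrder.Language.{0, u} where
  Functions := fun _ => Empty
  Relations := TreeRel Λ

/-- A `Λ`-labelled binary tree as a relational structure on its set of nodes. -/
instance treeStructure {Λ : Type u} (T : BinaryTree Λ) : (treeLanguage Λ).Structure (Node T) where
  funMap := fun f _ => Empty.elim f
  RelMap := fun R =>
    match R with
    | .left => fun t => IsLeftChild (t 0) (t 1)
    | .right => fun t => IsRightChild (t 0) (t 1)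
    | .label a => fun t => (t 0).label = a

end LabelledTree

/-! ### Counting monadic second-order logic -/

/-- `CMSOFormula L α n m`: formulas of monadic second-order logic with modular counting predicates
over the signature `L`, with free element variables indexed by `α`, and with `n` further element
variables and `m` set variables available for quantification. -/
inductive CMSOFormula (L : FirstOrder.Language.{u, v}) (α : Type w) : ℕ → ℕ → Type (max u v w)
  /-- falsity -/
  | falsum {n m : ℕ} : CMSOFormula L α n m
  /-- equality of two elements -/
  | equal {n m : ℕ} (t₁ t₂ : L.Term (α ⊕ Fin n)) : CMSOFormula L α n m
  /-- a relation symbol of the signature -/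
  | rel {n m k : ℕ} (R : L.Relations k) (ts : Fin k → L.Term (α ⊕ Fin n)) : CMSOFormula L α n m
  /-- membership of an element in a set variable -/
  | mem {n m : ℕ} (t : L.Term (α ⊕ Fin n)) (Z : Fin m) : CMSOFormula L α n m
  /-- the modular predicate `|Z| ≡ a mod p` -/
  | modCard {n m : ℕ} (Z : Fin m) (a p : ℤ) : CMSOFormula L α n m
  /-- negation -/
  | neg {n m : ℕ} (φ : CMSOFormula L α n m) : CMSOFormula L α n m
  /-- conjunction -/
  | and {n m : ℕ} (φ ψ : CMSOFormula L α n m) : CMSOFormula L α n m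
  /-- existential quantification over elements -/
  | ex {n m : ℕ} (φ : CMSOFormula L α (n + 1) m) : CMSOFormula L α n m
  /-- existential quantification over sets of elements -/
  | exSet {n m : ℕ} (φ : CMSOFormula L α n (m + 1)) : CMSOFormula L α n m

namespace CMSOFormula

/-- Satisfaction in an `L`-structure `M`, given values `f` of the free element variables, `e` of
the quantified element variables and `s` of the set variables. -/
def Realize {L : FirstOrder.Language.{u, v}} {M : Type u'} [L.Structure M] {α : Type w} :
    {n m : ℕ} → CMSOFormula L α n m → (α → M) → (Fin n → M) → (Fin m → Set M) → Prop
  | _, _, .falsum, _, _, _ => False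
  | _, _, .equal t₁ t₂, f, e, _ => t₁.realize (Sum.elim f e) = t₂.realize (Sum.elim f e)
  | _, _, .rel R ts, f, e, _ =>
      FirstOrder.Language.Structure.RelMap R fun i => (ts i).realize (Sum.elim f e)
  | _, _, .mem t Z, f, e, s => t.realize (Sum.elim f e) ∈ s Z
  | _, _, .modCard Z a p, _, _, s => (s Z).Finite ∧ ((s Z).ncard : ℤ) ≡ a [ZMOD p]
  | _, _, .neg φ, f, e, s => ¬ φ.Realize f e s
  | _, _, .and φ ψ, f, e, s => φ.Realize f e s ∧ ψ.Realize f e s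
  | _, _, .ex φ, f, e, s => ∃ x : M, φ.Realize f (Fin.snoc e x) s
  | _, _, .exSet φ, f, e, s => ∃ P : Set M, φ.Realize f e (Fin.snoc s P)

end CMSOFormula

/-- A partitioned formula `φ(x̄, ȳ)`: all free variables are element variables, and they are
partitioned into the object variables `X` and the parameter variables `Y`. -/
abbrev PartitionedCMSO (L : FirstOrder.Language.{u, v}) (X : Type w) (Y : Type w') :=
  CMSOFormula L (X ⊕ Y) 0 0

/-- `φ.Holds M p q`: the structure `M` satisfies `φ(p, q)`. -/
def PartitionedCMSO.Holds {L : FirstOrder.Language.{u, v}} {X : Type w} {Y : Type w'}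
    (φ : PartitionedCMSO L X Y) (M : Type u') [L.Structure M] (p : X → M) (q : Y → M) : Prop :=
  CMSOFormula.Realize φ (Sum.elim p q) Fin.elim0 Fin.elim0

/-- The family of sets of `S^φ(M)`: all sets `{p ∈ M^X : M ⊨ φ(p, q)}` for `q ∈ M^Y`. -/
def definableFamily {L : FirstOrder.Language.{u, v}} {X : Type w} {Y : Type w'}
    (φ : PartitionedCMSO L X Y) (M : Type u') [L.Structure M] : Set (Set (X → M)) :=
  {S | ∃ q : Y → M, S = {p | φ.Holds M p q}}

/-- The restriction `{S ∩ A^X : S ∈ F}` of a family `F` of sets of tuples of elements of `U` to a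
set `A` of elements of `U`. -/
def restrictFamily {U : Type u'} {X : Type w} (F : Set (Set (X → U))) (A : Set U) :
    Set (Set (X → U)) :=
  {R | ∃ S ∈ F, R = S ∩ {p | ∀ x, p x ∈ A}}

/-!
The proof reduces satisfaction of a formula to runs of a finite tree automaton, and then bounds the
number of ways in which the parameters can influence these runs.

A valuation of the variables is encoded by marks on the nodes. By induction on the formula,
satisfaction is decided by a deterministic bottom-up automaton reading the marked tree
(`LabelledTree.exists_recognizable`): the atomic formulas and the counting predicates are computed
by simple automata, and quantifiers are handled by the subset construction.

Now fix a tree and a set `A` of nodes. Cutting the tree at the nodes of `A` and at the nodes where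
two branches leading to `A` meet yields `O(|A|)` segments, each of which acts on states either as a
map `Q → Q`, where `Q` is the finite set of states, or as a single node
(`LabelledTree.Segmentation.exists_card_le`). This action, the type of the segment, depends only on
the parameters inside the segment, since no object lies there except at single nodes. The types of
all segments determine, for all tuples of objects from `A` at once, whether the automaton accepts.

A segment without parameters has a type that does not depend on the parameters. Hence the definable
set is determined once it is known, for each parameter, in which segment it lies and what the type
of that segment is (`LabelledTree.Segmentation.fullType_eq_of_code_eq`). There are `O(|A|)`
possibilities for each parameter, which gives `O(|A| ^ |ȳ|)` definable sets.
-/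

namespace LabelledTree

variable {Λ : Type u} {Γ : Type v} {Γ' : Type w}

/-! ### Nodes of a tree -/

instance : IsEmpty (Node (.nil : BinaryTree Λ)) := ⟨nofun⟩

/-- A node of a non-empty tree is the root, a node of the left or a node of the right subtree. -/
def nodeEquiv (a : Λ) (l r : BinaryTree Λ) : Node (.node a l r) ≃ Option (Node l ⊕ Node r) where
  toFun
    | .root _ _ _ => none
    | .inLeft _ _ t => some (.inl t)
    | .inRight _ _ t => some (.inr t)
  invFun
    | none => .root a l r
    | some (.inl t) => .inLeft a r t
    | some (.inr t) => .inRight a l t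
  left_inv t := by cases t <;> rfl
  right_inv t := by rcases t with _ | _ | _ <;> rfl

instance finite_node : (T : BinaryTree Λ) → Finite (Node T)
  | .nil => inferInstance
  | .node a l r =>
    have := finite_node l
    have := finite_node r
    .of_equiv _ (nodeEquiv a l r).symm

theorem exists_node_iff {a : Λ} {l r : BinaryTree Λ} {p : Node (.node a l r) → Prop} :
    (∃ t, p t) ↔ p (.root a l r) ∨ (∃ t, p (.inLeft a r t)) ∨ ∃ t, p (.inRight a l t) := by
  rw [← (nodeEquiv a l r).symm.exists_congr_right, Option.exists, Sum.exists]
  rfl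

open Classical in
theorem ncard_node {a : Λ} {l r : BinaryTree Λ} (A : Set (Node (.node a l r))) :
    A.ncard = (if .root a l r ∈ A then 1 else 0) + (Node.inLeft a r ⁻¹' A).ncard +
      (Node.inRight a l ⁻¹' A).ncard := by
  have := Fintype.ofFinite (Node l)
  have := Fintype.ofFinite (Node r)
  have := Fintype.ofFinite (Node (.node a l r))
  simp only [Set.ncard_eq_toFinset_card', ← Set.filter_mem_univ_eq_toFinset, Finset.card_filter]
  rw [← (nodeEquiv a l r).symm.sum_comp, Fintype.sum_option, Fintype.sum_sum_type, ← add_assoc]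
  rfl

/-! ### Bottom-up automata on coloured trees -/

/-- A deterministic bottom-up automaton with states `Q`, reading `Λ`-labelled trees whose nodes
carry an additional colour from `Γ`. -/
structure Automaton (Λ : Type u) (Γ : Type v) (Q : Type w) where
  /-- the state at a missing subtree -/
  nil : Q
  /-- the state at a node, from its label, its colour and the states at its two subtrees -/
  node : Λ → Γ → Q → Q → Q

/-- The state reached at the root of a tree `T` coloured by `c`. Colours are given as a function on
the nodes, so that recolouring does not change the type of the nodes. -/
def Automaton.eval {Q : Type u'} (M : Automaton Λ Γ Q) : (T : BinaryTree Λ) → (Node T → Γ) → Q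
  | .nil, _ => M.nil
  | .node a l r, c => M.node a (c (.root a l r)) (M.eval l fun t => c (.inLeft a r t))
      (M.eval r fun t => c (.inRight a l t))

/-- A property of coloured trees is recognizable if some automaton with finitely many states
decides it. -/
def Recognizable (R : ∀ T : BinaryTree Λ, (Node T → Γ) → Prop) : Prop :=
  ∃ (Q : Type) (_ : Finite Q) (M : Automaton Λ Γ Q) (F : Set Q), ∀ T c, R T c ↔ M.eval T c ∈ F

namespace Recognizable

/-- A property is recognizable if it can be read off from an invariant with finitely many values
that is computed from the root and the two subtrees. -/
theorem of_invariant {Q : Type} [Finite Q] (v : ∀ T : BinaryTree Λ, (Node T → Γ) → Q) (q₀ : Q)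
    (δ : Λ → Γ → Q → Q → Q) (h₀ : ∀ c, v .nil c = q₀)
    (h : ∀ a l r c, v (.node a l r) c = δ a (c (.root a l r)) (v l fun t => c (.inLeft a r t))
      (v r fun t => c (.inRight a l t))) (F : Set Q) :
    Recognizable fun T c => v T c ∈ F := by
  refine ⟨Q, inferInstance, ⟨q₀, δ⟩, F, fun T c => ?_⟩
  suffices hv : Automaton.eval ⟨q₀, δ⟩ T c = v T c by rw [hv]
  induction T with
  | nil => exact (h₀ c).symm
  | node a l r hl hr => rw [h, ← hl, ← hr]; rfl

theorem congr {R S : ∀ T : BinaryTree Λ, (Node T → Γ) → Prop} (hR : Recognizable R)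
    (h : ∀ T c, S T c ↔ R T c) : Recognizable S := by
  obtain ⟨Q, hQ, M, F, hF⟩ := hR
  exact ⟨Q, hQ, M, F, fun T c => (h T c).trans (hF T c)⟩

theorem not {R : ∀ T : BinaryTree Λ, (Node T → Γ) → Prop} (hR : Recognizable R) :
    Recognizable fun T c => ¬ R T c := by
  obtain ⟨Q, hQ, M, F, hF⟩ := hR
  exact ⟨Q, hQ, M, Fᶜ, fun T c => not_congr (hF T c)⟩

theorem and {R S : ∀ T : BinaryTree Λ, (Node T → Γ) → Prop} (hR : Recognizable R)
    (hS : Recognizable S) : Recognizable fun T c => R T c ∧ S T c := by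
  obtain ⟨Q, hQ, M, F, hF⟩ := hR
  obtain ⟨Q', hQ', M', F', hF'⟩ := hS
  refine (of_invariant (fun T c => (M.eval T c, M'.eval T c)) (M.nil, M'.nil)
    (fun a g q q' => (M.node a g q.1 q'.1, M'.node a g q.2 q'.2)) (fun _ => rfl)
    (fun _ _ _ _ => rfl) (F ×ˢ F')).congr fun T c => ?_
  rw [hF, hF', Set.mem_prod]

theorem false : Recognizable fun (T : BinaryTree Λ) (_ : Node T → Γ) => False :=
  ⟨Unit, inferInstance, ⟨(), fun _ _ _ _ => ()⟩, ∅, fun _ _ => Iff.rfl⟩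

theorem recolour {R : ∀ T : BinaryTree Λ, (Node T → Γ') → Prop} (hR : Recognizable R)
    (g : Γ → Γ') : Recognizable fun T (c : Node T → Γ) => R T fun t => g (c t) := by
  obtain ⟨Q, hQ, M, F, hF⟩ := hR
  refine (of_invariant (fun T c => M.eval T fun t => g (c t)) M.nil
    (fun a x q q' => M.node a (g x) q q') (fun _ => rfl) (fun _ _ _ _ => rfl) F).congr
    fun T c => hF _ _

/-- Closure under projection, by the subset construction. -/
theorem exists_set {R : ∀ T : BinaryTree Λ, (Node T → Γ × Prop) → Prop} (hR : Recognizable R) :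
    Recognizable fun T (c : Node T → Γ) => ∃ P : Set (Node T), R T fun t => (c t, t ∈ P) := by
  obtain ⟨Q, hQ, M, F, hF⟩ := hR
  refine (of_invariant
    (fun T c => {q | ∃ P : Set (Node T), M.eval T (fun t => (c t, t ∈ P)) = q}) {M.nil}
    (fun a x U V => {q | ∃ b : Prop, ∃ q₁ ∈ U, ∃ q₂ ∈ V, M.node a (x, b) q₁ q₂ = q}) ?_ ?_
    {U | (U ∩ F).Nonempty}).congr fun T c => ?_
  · intro c
    ext q
    simp [Automaton.eval, eq_comm]
  · intro a l r c
    ext q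
    constructor
    · rintro ⟨P, rfl⟩
      exact ⟨.root a l r ∈ P, _, ⟨Node.inLeft a r ⁻¹' P, rfl⟩, _, ⟨Node.inRight a l ⁻¹' P, rfl⟩,
        rfl⟩
    · rintro ⟨b, _, ⟨P₁, rfl⟩, _, ⟨P₂, rfl⟩, rfl⟩
      refine ⟨{t | match t with
        | .root _ _ _ => b
        | .inLeft _ _ t => t ∈ P₁
        | .inRight _ _ t => t ∈ P₂}, rfl⟩
  · simp only [hF]
    constructor
    · rintro ⟨P, hP⟩
      exact ⟨_, ⟨P, rfl⟩, hP⟩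
    · rintro ⟨_, ⟨P, rfl⟩, hP⟩
      exact ⟨P, hP⟩

theorem exists_node (p : Λ → Γ → Prop) :
    Recognizable fun T c => ∃ t : Node T, p t.label (c t) :=
  of_invariant (Q := Prop) (fun T c => ∃ t : Node T, p t.label (c t)) False
    (fun a x P P' => p a x ∨ P ∨ P') (fun _ => by simp)
    (fun _ _ _ _ => propext exists_node_iff) {P | P}

/-- The colour of the root exists and satisfies `p`. -/
def RootSat (p : Γ → Prop) : (T : BinaryTree Λ) → (Node T → Γ) → Prop
  | .nil, _ => False
  | .node a l r, c => p (c (.root a l r))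

theorem exists_isLeftChild_node {a : Λ} {l r : BinaryTree Λ} (p p' : Γ → Prop)
    (c : Node (.node a l r) → Γ) :
    (∃ s t, IsLeftChild s t ∧ p (c s) ∧ p' (c t)) ↔
      (p (c (.root a l r)) ∧ RootSat p' l fun t => c (.inLeft a r t)) ∨
      (∃ s t, IsLeftChild s t ∧ p (c (.inLeft a r s)) ∧ p' (c (.inLeft a r t))) ∨
      ∃ s t, IsLeftChild s t ∧ p (c (.inRight a l s)) ∧ p' (c (.inRight a l t)) := by
  constructor
  · rintro ⟨s, t, h, hs, ht⟩
    cases h with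
    | root a b l l' r => exact .inl ⟨hs, ht⟩
    | inLeft a r h => exact .inr (.inl ⟨_, _, h, hs, ht⟩)
    | inRight a l h => exact .inr (.inr ⟨_, _, h, hs, ht⟩)
  · rintro (⟨hs, ht⟩ | ⟨s, t, h, hs, ht⟩ | ⟨s, t, h, hs, ht⟩)
    · cases l with
      | nil => exact ht.elim
      | node b l l' => exact ⟨_, _, .root a b l l' r, hs, ht⟩
    · exact ⟨_, _, .inLeft a r h, hs, ht⟩
    · exact ⟨_, _, .inRight a l h, hs, ht⟩

theorem exists_isRightChild_node {a : Λ} {l r : BinaryTree Λ} (p p' : Γ → Prop)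
    (c : Node (.node a l r) → Γ) :
    (∃ s t, IsRightChild s t ∧ p (c s) ∧ p' (c t)) ↔
      (p (c (.root a l r)) ∧ RootSat p' r fun t => c (.inRight a l t)) ∨
      (∃ s t, IsRightChild s t ∧ p (c (.inLeft a r s)) ∧ p' (c (.inLeft a r t))) ∨
      ∃ s t, IsRightChild s t ∧ p (c (.inRight a l s)) ∧ p' (c (.inRight a l t)) := by
  constructor
  · rintro ⟨s, t, h, hs, ht⟩
    cases h with
    | root a b l r r' => exact .inl ⟨hs, ht⟩
    | inLeft a r h => exact .inr (.inl ⟨_, _, h, hs, ht⟩)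
    | inRight a l h => exact .inr (.inr ⟨_, _, h, hs, ht⟩)
  · rintro (⟨hs, ht⟩ | ⟨s, t, h, hs, ht⟩ | ⟨s, t, h, hs, ht⟩)
    · cases r with
      | nil => exact ht.elim
      | node b r r' => exact ⟨_, _, .root a b l r r', hs, ht⟩
    · exact ⟨_, _, .inLeft a r h, hs, ht⟩
    · exact ⟨_, _, .inRight a l h, hs, ht⟩

theorem exists_isLeftChild (p p' : Γ → Prop) : Recognizable fun (T : BinaryTree Λ) c =>
    ∃ s t : Node T, IsLeftChild s t ∧ p (c s) ∧ p' (c t) :=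
  of_invariant (Q := Prop × Prop)
    (fun T c => (RootSat p' T c, ∃ s t : Node T, IsLeftChild s t ∧ p (c s) ∧ p' (c t)))
    (False, False) (fun _ x P P' => (p' x, (p x ∧ P.1) ∨ P.2 ∨ P'.2)) (fun _ => by simp [RootSat])
    (fun _ _ _ c => Prod.ext rfl (propext (exists_isLeftChild_node p p' c))) {P | P.2}

theorem exists_isRightChild (p p' : Γ → Prop) : Recognizable fun (T : BinaryTree Λ) c =>
    ∃ s t : Node T, IsRightChild s t ∧ p (c s) ∧ p' (c t) :=
  of_invariant (Q := Prop × Prop)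
    (fun T c => (RootSat p' T c, ∃ s t : Node T, IsRightChild s t ∧ p (c s) ∧ p' (c t)))
    (False, False) (fun _ x P P' => (p' x, (p x ∧ P'.1) ∨ P.2 ∨ P'.2)) (fun _ => by simp [RootSat])
    (fun _ _ _ c => Prod.ext rfl (propext (exists_isRightChild_node p p' c))) {P | P.2}

open Classical in
/-- Counting in a finite additive quotient of `ℕ` can be done by an automaton. -/
theorem ncard_mem {Q : Type} [Finite Q] (f : ℕ → Q) (g : Q → Q → Q)
    (hf : ∀ i j, f (i + j) = g (f i) (f j)) (F : Set Q) (p : Γ → Prop) :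
    Recognizable fun (T : BinaryTree Λ) c => f {t : Node T | p (c t)}.ncard ∈ F := by
  refine of_invariant (fun T c => f {t : Node T | p (c t)}.ncard) (f 0)
    (fun _ x q q' => g (g (f (if p x then 1 else 0)) q) q') (fun c => ?_) (fun a l r c => ?_) F
  · rw [Set.eq_empty_of_isEmpty {t : Node .nil | p (c t)}, Set.ncard_empty]
  · rw [ncard_node, hf, hf]
    rfl

theorem ncard_modEq (p : Γ → Prop) (a n : ℤ) : Recognizable fun (T : BinaryTree Λ) c =>
    ({t : Node T | p (c t)}.ncard : ℤ) ≡ a [ZMOD n] := by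
  obtain rfl | hn := eq_or_ne n 0
  · -- Modulo `0` the predicate says `|Z| = a`; it suffices to count up to `a + 1`.
    let N := a.toNat + 1
    refine (ncard_mem (Q := Fin (N + 1)) (fun k => ⟨min k N, by omega⟩)
      (fun i j => ⟨min (i + j) N, by omega⟩) (fun i j => ?_) {i | (i.val : ℤ) = a} p).congr
      fun T c => ?_
    · simp only [Fin.mk.injEq]
      omega
    · simp only [Int.modEq_zero_iff, Set.mem_ofPred_eq]
      omega
  · have : NeZero n.natAbs := ⟨Int.natAbs_ne_zero.2 hn⟩
    refine (ncard_mem (Q := ZMod n.natAbs) (fun k => (k : ZMod n.natAbs)) (· + ·)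
      (fun i j => Nat.cast_add i j) {(a : ZMod n.natAbs)} p).congr fun T c => ?_
    rw [Set.mem_singleton_iff, ← Int.cast_natCast (R := ZMod n.natAbs), ZMod.intCast_eq_intCast_iff,
      Int.modEq_iff_dvd, Int.modEq_iff_dvd, Int.natAbs_dvd]

theorem exists_singleton {R : ∀ T : BinaryTree Λ, (Node T → Γ × Prop) → Prop}
    (hR : Recognizable R) :
    Recognizable fun T (c : Node T → Γ) => ∃ x : Node T, R T fun t => (c t, t = x) := by
  refine ((ncard_modEq (fun x : Γ × Prop => x.2) 1 0).and hR).exists_set.congr fun T c => ?_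
  have h1 (P : Set (Node T)) : ((P.ncard : ℤ) ≡ 1 [ZMOD 0]) ↔ ∃ x, P = {x} := by
    rw [Int.modEq_zero_iff, ← Set.ncard_eq_one]
    omega
  constructor
  · rintro ⟨x, hx⟩
    exact ⟨{x}, (h1 {x}).2 ⟨x, rfl⟩, hx⟩
  · rintro ⟨P, hP, h⟩
    obtain ⟨x, rfl⟩ := (h1 P).1 hP
    exact ⟨x, h⟩

end Recognizable

/-! ### Formulas are recognizable -/

section Formula

variable {α : Type v} {n m : ℕ} {T : BinaryTree Λ}

/-- The colouring that encodes a valuation: the colour of a node consists of the element variables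
whose value it is and of the set variables whose value contains it. -/
def marking (e : α → Node T) (s : Fin m → Set (Node T)) (t : Node T) : Set α × Set (Fin m) :=
  ({x | e x = t}, {Z | t ∈ s Z})

/-- Interprets an additional mark on the nodes as the value of a new last element variable. -/
def addElem (x : (Set (α ⊕ Fin n) × Set (Fin m)) × Prop) : Set (α ⊕ Fin (n + 1)) × Set (Fin m) :=
  ({z | Sum.elim (fun i => .inl i ∈ x.1.1)
    (Fin.snoc (α := fun _ => Prop) (fun i => .inr i ∈ x.1.1) x.2) z}, x.1.2)

/-- Interprets an additional mark on the nodes as membership in a new last set variable. -/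
def addSet (x : (Set α × Set (Fin m)) × Prop) : Set α × Set (Fin (m + 1)) :=
  (x.1.1, {Z | Fin.snoc (α := fun _ => Prop) (fun i => i ∈ x.1.2) x.2 Z})

theorem marking_snoc_elem (f : α → Node T) (e : Fin n → Node T) (s : Fin m → Set (Node T))
    (x : Node T) :
    marking (Sum.elim f (Fin.snoc e x : Fin (n + 1) → Node T)) s =
      fun t => addElem (marking (Sum.elim f e) s t, t = x) := by
  funext t
  refine Prod.ext (Set.ext fun z => ?_) rfl
  rcases z with z | z
  · rfl
  · induction z using Fin.lastCases <;> simp [marking, addElem, eq_comm]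

theorem marking_snoc_set (e : α → Node T) (s : Fin m → Set (Node T)) (P : Set (Node T)) :
    marking e (Fin.snoc s P : Fin (m + 1) → Set (Node T)) =
      fun t => addSet (marking e s t, t ∈ P) := by
  funext t
  refine Prod.ext rfl (Set.ext fun z => ?_)
  induction z using Fin.lastCases <;> simp [marking, addSet]

/-- As the signature has no function symbols, every term is a variable. -/
theorem exists_term_eq_var {β : Type w} (t : (treeLanguage Λ).Term β) : ∃ x, t = .var x := by
  cases t with
  | var x => exact ⟨x, rfl⟩
  | func f _ => exact Empty.elim f

/-- Satisfaction of a fixed formula is decided by a finite automaton reading the tree together with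
the marking of its nodes by the valuation. -/
theorem exists_recognizable (φ : CMSOFormula (treeLanguage Λ) α n m) :
    ∃ R : ∀ T : BinaryTree Λ, (Node T → Set (α ⊕ Fin n) × Set (Fin m)) → Prop,
      Recognizable R ∧ ∀ (T : BinaryTree Λ) (f : α → Node T) (e : Fin n → Node T)
        (s : Fin m → Set (Node T)), φ.Realize f e s ↔ R T (marking (Sum.elim f e) s) := by
  induction φ with
  | falsum => exact ⟨_, .false, fun _ _ _ _ => Iff.rfl⟩
  | equal t₁ t₂ =>
    obtain ⟨x, rfl⟩ := exists_term_eq_var t₁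
    obtain ⟨y, rfl⟩ := exists_term_eq_var t₂
    refine ⟨_, .exists_node fun _ g => x ∈ g.1 ∧ y ∈ g.1, fun T f e s => ?_⟩
    simp [CMSOFormula.Realize, marking, eq_comm]
  | rel R ts =>
    choose x hx using fun i => exists_term_eq_var (ts i)
    obtain rfl : ts = fun i => .var (x i) := funext hx
    cases R with
    | left =>
      refine ⟨_, .exists_isLeftChild (fun g => x 0 ∈ g.1) (fun g => x 1 ∈ g.1), fun T f e s => ?_⟩
      simp [CMSOFormula.Realize, marking, FirstOrder.Language.Structure.RelMap]
    | right =>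
      refine ⟨_, .exists_isRightChild (fun g => x 0 ∈ g.1) (fun g => x 1 ∈ g.1), fun T f e s => ?_⟩
      simp [CMSOFormula.Realize, marking, FirstOrder.Language.Structure.RelMap]
    | label a =>
      refine ⟨_, .exists_node fun b g => b = a ∧ x 0 ∈ g.1, fun T f e s => ?_⟩
      simp [CMSOFormula.Realize, marking, FirstOrder.Language.Structure.RelMap]
  | mem t Z =>
    obtain ⟨x, rfl⟩ := exists_term_eq_var t
    refine ⟨_, .exists_node fun _ g => x ∈ g.1 ∧ Z ∈ g.2, fun T f e s => ?_⟩
    simp [CMSOFormula.Realize, marking]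
  | modCard Z a p =>
    refine ⟨_, .ncard_modEq (fun g => Z ∈ g.2) a p, fun T f e s => ?_⟩
    exact and_iff_right (Set.toFinite (s Z))
  | neg φ ih =>
    obtain ⟨R, hR, h⟩ := ih
    exact ⟨_, hR.not, fun T f e s => not_congr (h T f e s)⟩
  | and φ ψ ihφ ihψ =>
    obtain ⟨R, hR, h⟩ := ihφ
    obtain ⟨R', hR', h'⟩ := ihψ
    exact ⟨_, hR.and hR', fun T f e s => and_congr (h T f e s) (h' T f e s)⟩
  | ex φ ih =>
    obtain ⟨R, hR, h⟩ := ih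
    refine ⟨_, (hR.recolour addElem).exists_singleton, fun T f e s => exists_congr fun x => ?_⟩
    rw [h, marking_snoc_elem]
  | exSet φ ih =>
    obtain ⟨R, hR, h⟩ := ih
    refine ⟨_, (hR.recolour addSet).exists_set, fun T f e s => exists_congr fun P => ?_⟩
    rw [h, marking_snoc_set]

end Formula

/-! ### Cutting a tree into segments -/

variable {Γ₁ : Type v} {Γ₂ : Type w} {Q : Type}

/-- A partition of the nodes of a tree `T` into segments: a top segment, given by `seg t = none`,
and segments indexed by `ι`. Each segment has a type that depends only on the `Γ₂`-colours inside
it. As long as the `Γ₁`-colours are `d` outside the set `A`, the types determine the state of the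
automaton `M`. The type of the top segment is a map of states: the contribution of the top segment
is to apply that map to a state determined by everything below. -/
structure Segmentation (M : Automaton Λ (Γ₁ × Γ₂) Q) (d : Γ₁) {T : BinaryTree Λ}
    (A : Set (Node T)) where
  /-- the segments other than the top segment -/
  ι : Type
  [fintype : Fintype ι]
  /-- the segment of a node -/
  seg : Node T → Option ι
  /-- the type of the top segment -/
  top : (Node T → Γ₂) → Q → Q
  /-- the types of the other segments -/
  type : (Node T → Γ₂) → ι → (Q → Q) ⊕ Γ₂
  top_congr : ∀ c c', (∀ t, seg t = none → c t = c' t) → top c = top c'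
  type_congr : ∀ c c' i, (∀ t, seg t = some i → c t = c' t) → type c i = type c' i
  eval_eq : ∀ c c', type c = type c' → ∀ b : Node T → Γ₁, (∀ t, t ∉ A → b t = d) →
    ∃ q, M.eval T (fun t => (b t, c t)) = top c q ∧ M.eval T (fun t => (b t, c' t)) = top c' q

namespace Segmentation

attribute [instance] Segmentation.fintype

variable {M : Automaton Λ (Γ₁ × Γ₂) Q} {d : Γ₁}

/-- If `A` is empty, then a single segment suffices, whose type is a constant map. -/
def ofEmpty {T : BinaryTree Λ} {A : Set (Node T)} (hA : A = ∅) : Segmentation M d A where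
  ι := Empty
  seg _ := none
  top c _ := M.eval T fun t => (d, c t)
  type _ := Empty.elim
  top_congr c c' h := by rw [funext fun t => h t rfl]
  type_congr _ _ i := i.elim
  eval_eq c c' _ b hb := by
    obtain rfl : b = fun _ => d := funext fun t => hb t (hA ▸ Set.notMem_empty t)
    exact ⟨M.nil, rfl, rfl⟩

variable {a : Λ} {l r : BinaryTree Λ} {A : Set (Node (.node a l r))}

/-- If `A` lies in the left subtree, then the root and the right subtree can be added to the top
segment of the left subtree. -/
def extendLeft (S : Segmentation M d (Node.inLeft a r ⁻¹' A)) (h : .root a l r ∉ A)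
    (hr : Node.inRight a l ⁻¹' A = ∅) : Segmentation M d A where
  ι := S.ι
  seg
    | .root _ _ _ => none
    | .inLeft _ _ t => S.seg t
    | .inRight _ _ _ => none
  top c q := M.node a (d, c (.root a l r)) (S.top (fun t => c (.inLeft a r t)) q)
    (M.eval r fun t => (d, c (.inRight a l t)))
  type c := S.type fun t => c (.inLeft a r t)
  top_congr c c' hc := by
    rw [hc (.root a l r) rfl, S.top_congr _ (fun t => c' (.inLeft a r t)) fun t ht => hc _ ht,
      funext fun t : Node r => congrArg (Prod.mk d) (hc (.inRight a l t) rfl)]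
  type_congr c c' i hc := S.type_congr _ _ i fun t ht => hc (.inLeft a r t) ht
  eval_eq c c' hc b hb := by
    obtain ⟨q, h₁, h₂⟩ := S.eval_eq _ _ hc (fun t => b (.inLeft a r t)) fun t ht => hb _ ht
    have hbr (t : Node r) : b (.inRight a l t) = d :=
      hb _ (Set.eq_empty_iff_forall_notMem.1 hr t)
    exact ⟨q, by simp only [Automaton.eval, hb _ h, h₁, hbr],
      by simp only [Automaton.eval, hb _ h, h₂, hbr]⟩

/-- If `A` lies in the right subtree, then the root and the left subtree can be added to the top
segment of the right subtree. -/
def extendRight (S : Segmentation M d (Node.inRight a l ⁻¹' A)) (h : .root a l r ∉ A)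
    (hl : Node.inLeft a r ⁻¹' A = ∅) : Segmentation M d A where
  ι := S.ι
  seg
    | .root _ _ _ => none
    | .inLeft _ _ _ => none
    | .inRight _ _ t => S.seg t
  top c q := M.node a (d, c (.root a l r)) (M.eval l fun t => (d, c (.inLeft a r t)))
    (S.top (fun t => c (.inRight a l t)) q)
  type c := S.type fun t => c (.inRight a l t)
  top_congr c c' hc := by
    rw [hc (.root a l r) rfl, S.top_congr _ (fun t => c' (.inRight a l t)) fun t ht => hc _ ht,
      funext fun t : Node l => congrArg (Prod.mk d) (hc (.inLeft a r t) rfl)]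
  type_congr c c' i hc := S.type_congr _ _ i fun t ht => hc (.inRight a l t) ht
  eval_eq c c' hc b hb := by
    obtain ⟨q, h₁, h₂⟩ := S.eval_eq _ _ hc (fun t => b (.inRight a l t)) fun t ht => hb _ ht
    have hbl (t : Node l) : b (.inLeft a r t) = d :=
      hb _ (Set.eq_empty_iff_forall_notMem.1 hl t)
    exact ⟨q, by simp only [Automaton.eval, hb _ h, h₁, hbl],
      by simp only [Automaton.eval, hb _ h, h₂, hbl]⟩

/-- Segmentations of the two subtrees give one of the whole tree: the root becomes a segment of its
own, whose type is its colour, and the new top segment is empty. -/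
def join (S : Segmentation M d (Node.inLeft a r ⁻¹' A))
    (S' : Segmentation M d (Node.inRight a l ⁻¹' A)) : Segmentation M d A where
  ι := Option (Option S.ι ⊕ Option S'.ι)
  seg
    | .root _ _ _ => some none
    | .inLeft _ _ t => some (some (.inl (S.seg t)))
    | .inRight _ _ t => some (some (.inr (S'.seg t)))
  top _ := id
  type c
    | none => .inr (c (.root a l r))
    | some (.inl none) => .inl (S.top fun t => c (.inLeft a r t))
    | some (.inl (some i)) => S.type (fun t => c (.inLeft a r t)) i
    | some (.inr none) => .inl (S'.top fun t => c (.inRight a l t))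
    | some (.inr (some i)) => S'.type (fun t => c (.inRight a l t)) i
  top_congr _ _ _ := rfl
  type_congr c c' i hc := by
    match i with
    | none => exact congrArg Sum.inr (hc (.root a l r) rfl)
    | some (.inl none) =>
      exact congrArg Sum.inl (S.top_congr _ _ fun t ht => hc (.inLeft a r t) (by simp [ht]))
    | some (.inl (some i)) => exact S.type_congr _ _ i fun t ht => hc (.inLeft a r t) (by simp [ht])
    | some (.inr none) =>
      exact congrArg Sum.inl (S'.top_congr _ _ fun t ht => hc (.inRight a l t) (by simp [ht]))
    | some (.inr (some i)) =>
      exact S'.type_congr _ _ i fun t ht => hc (.inRight a l t) (by simp [ht])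
  eval_eq c c' hc b hb := by
    have h₀ := Sum.inr_injective (congrFun hc none)
    have hl := Sum.inl_injective (congrFun hc (some (.inl none)))
    have hr := Sum.inl_injective (congrFun hc (some (.inr none)))
    obtain ⟨q, h₁, h₂⟩ := S.eval_eq (fun t => c (.inLeft a r t)) (fun t => c' (.inLeft a r t))
      (funext fun i => congrFun hc (some (.inl (some i)))) (fun t => b (.inLeft a r t))
      fun t ht => hb _ ht
    obtain ⟨q', h₁', h₂'⟩ := S'.eval_eq (fun t => c (.inRight a l t))
      (fun t => c' (.inRight a l t)) (funext fun i => congrFun hc (some (.inr (some i))))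
      (fun t => b (.inRight a l t)) fun t ht => hb _ ht
    refine ⟨_, rfl, ?_⟩
    simp only [Automaton.eval, h₁, h₂, h₁', h₂', id]
    rw [h₀, hl, hr]

theorem card_join (S : Segmentation M d (Node.inLeft a r ⁻¹' A))
    (S' : Segmentation M d (Node.inRight a l ⁻¹' A)) :
    Fintype.card (S.join S').ι = Fintype.card S.ι + 1 + (Fintype.card S'.ι + 1) + 1 := by
  change Fintype.card (Option (Option S.ι ⊕ Option S'.ι)) = _
  rw [Fintype.card_option, Fintype.card_sum, Fintype.card_option, Fintype.card_option]

/-- The number of segments is linear in `|A|`, whatever the size of the tree: `join` adds three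
segments and is needed only at the at most `2 * |A| - 1` nodes that belong to `A` or have nodes of
`A` in both subtrees; for `A = ∅` the truncated bound is `0`. -/
theorem exists_card_le (M : Automaton Λ (Γ₁ × Γ₂) Q) (d : Γ₁) (T : BinaryTree Λ)
    (A : Set (Node T)) : ∃ S : Segmentation M d A, Fintype.card S.ι ≤ 6 * A.ncard - 3 := by
  induction T with
  | nil => exact ⟨ofEmpty A.eq_empty_of_isEmpty, Nat.zero_le _⟩
  | node a l r ihl ihr =>
    obtain ⟨S, hS⟩ := ihl (Node.inLeft a r ⁻¹' A)
    obtain ⟨S', hS'⟩ := ihr (Node.inRight a l ⁻¹' A)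
    have hcard := ncard_node A
    by_cases h : .root a l r ∈ A
    · refine ⟨S.join S', ?_⟩
      have := card_join S S'
      rw [if_pos h] at hcard
      omega
    rw [if_neg h] at hcard
    obtain hl | hl := (Node.inLeft a r ⁻¹' A).eq_empty_or_nonempty
    · refine ⟨S'.extendRight h hl, hS'.trans ?_⟩
      omega
    obtain hr | hr := (Node.inRight a l ⁻¹' A).eq_empty_or_nonempty
    · refine ⟨S.extendLeft h hr, hS.trans ?_⟩
      omega
    · refine ⟨S.join S', ?_⟩
      have := card_join S S'
      have := hl.ncard_pos
      have := hr.ncard_pos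
      omega

/-- The type of a segment, including the top one. -/
def fullType {T : BinaryTree Λ} {A : Set (Node T)} (S : Segmentation M d A) (c : Node T → Γ₂) :
    Option S.ι → (Q → Q) ⊕ Γ₂
  | none => .inl (S.top c)
  | some i => S.type c i

theorem fullType_congr {T : BinaryTree Λ} {A : Set (Node T)} (S : Segmentation M d A)
    {c c' : Node T → Γ₂} {i : Option S.ι} (h : ∀ t, S.seg t = i → c t = c' t) :
    S.fullType c i = S.fullType c' i := by
  cases i with
  | none => exact congrArg Sum.inl (S.top_congr c c' h)
  | some i => exact S.type_congr c c' i h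

theorem eval_eq_of_fullType_eq {T : BinaryTree Λ} {A : Set (Node T)} (S : Segmentation M d A)
    {c c' : Node T → Γ₂} (h : S.fullType c = S.fullType c') {b : Node T → Γ₁}
    (hb : ∀ t, t ∉ A → b t = d) :
    M.eval T (fun t => (b t, c t)) = M.eval T (fun t => (b t, c' t)) := by
  obtain ⟨q, h₁, h₂⟩ := S.eval_eq c c' (funext fun i => congrFun h (some i)) b hb
  have htop : S.top c = S.top c' := Sum.inl_injective (congrFun h none)
  rw [h₁, h₂, htop]

/-- The code of a tuple of parameters: for each of them, its segment and the type of that segment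
when the nodes are coloured by the tuple. -/
def code {Y : Type w} {M : Automaton Λ (Γ₁ × Set Y) Q} {T : BinaryTree Λ} {A : Set (Node T)}
    (S : Segmentation M d A) (q : Y → Node T) (y : Y) : Option S.ι × ((Q → Q) ⊕ Set Y) :=
  (S.seg (q y), S.fullType (fun t => {z | q z = t}) (S.seg (q y)))

/-- The segments that contain no parameter have the type of the uncoloured segment, so the code of
the parameters determines the types of all segments. -/
theorem fullType_eq_of_code_eq {Y : Type w} {M : Automaton Λ (Γ₁ × Set Y) Q} {T : BinaryTree Λ}
    {A : Set (Node T)} (S : Segmentation M d A) {q q' : Y → Node T} (h : S.code q = S.code q') :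
    S.fullType (fun t => {z | q z = t}) = S.fullType (fun t => {z | q' z = t}) := by
  have hseg (y : Y) : S.seg (q y) = S.seg (q' y) := congrArg Prod.fst (congrFun h y)
  funext i
  by_cases hi : ∃ y, S.seg (q y) = i
  · obtain ⟨y, rfl⟩ := hi
    have := congrArg Prod.snd (congrFun h y)
    simp only [code, ← hseg] at this
    exact this
  · refine S.fullType_congr fun t ht => Set.ext fun y => iff_of_false ?_ ?_
    · rintro rfl
      exact hi ⟨y, ht⟩
    · rintro rfl
      exact hi ⟨y, (hseg y).trans ht⟩

end Segmentation

end LabelledTree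

/-! ### Counting definable sets -/

open LabelledTree in
/-- A partitioned formula is decided by a finite automaton reading the marks of the object
variables and those of the parameter variables. -/
theorem PartitionedCMSO.exists_automaton {Λ : Type u} {X : Type v} {Y : Type w}
    (φ : PartitionedCMSO (treeLanguage Λ) X Y) :
    ∃ (Q : Type) (_ : Finite Q) (M : Automaton Λ (Set X × Set Y) Q) (F : Set Q),
      ∀ (T : BinaryTree Λ) (p : X → Node T) (q : Y → Node T),
        φ.Holds (Node T) p q ↔ M.eval T (fun t => ({x | p x = t}, {y | q y = t})) ∈ F := by
  obtain ⟨R, hR, h⟩ := exists_recognizable φ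
  obtain ⟨Q, hQ, M, F, hF⟩ := hR.recolour fun g : Set X × Set Y =>
    ({z | Sum.elim (Sum.elim (· ∈ g.1) (· ∈ g.2)) (fun _ : Fin 0 => False) z}, (∅ : Set (Fin 0)))
  refine ⟨Q, hQ, M, F, fun T p q => ?_⟩
  rw [← hF, PartitionedCMSO.Holds, h]
  refine iff_of_eq (congrArg (R T) (funext fun t => Prod.ext (Set.ext fun z => ?_) ?_))
  · rcases z with (z | z) | z
    · rfl
    · rfl
    · exact z.elim0
  · exact Set.ext fun Z => Z.elim0

theorem Set.encard_range_le_of_factorsThrough {α : Type u} {β : Type v} {γ : Type w} [Fintype γ]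
    {f : α → β} {g : α → γ} (h : ∀ x y, g x = g y → f x = f y) :
    (Set.range f).encard ≤ Fintype.card γ := by
  rcases isEmpty_or_nonempty β with hβ | hβ
  · simp [Set.eq_empty_of_isEmpty (Set.range f)]
  obtain ⟨k, rfl⟩ := (Function.factorsThrough_iff f).1 fun x y hxy => h x y hxy
  rw [Set.range_comp]
  refine (Set.encard_image_le k _).trans ((Set.encard_le_encard (Set.subset_univ _)).trans ?_)
  simp

theorem theorem3 {Λ : Type u} [Finite Λ] (C : Set (BinaryTree Λ))
    {X : Type v} {Y : Type w} [Fintype X] [Fintype Y]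
    (φ : PartitionedCMSO (LabelledTree.treeLanguage Λ) X Y) :
    ∃ c : ℕ, ∀ T ∈ C, ∀ A : Set (LabelledTree.Node T), A.Nonempty →
      (restrictFamily (definableFamily φ (LabelledTree.Node T)) A).encard
        ≤ (c : ℕ∞) * A.encard ^ Fintype.card Y := by
  classical
  obtain ⟨Q, hQ, M, F, hF⟩ := φ.exists_automaton
  have := Fintype.ofFinite Q
  refine ⟨(6 * Fintype.card ((Q → Q) ⊕ Set Y)) ^ Fintype.card Y, fun T _ A hA => ?_⟩
  obtain ⟨S, hS⟩ := LabelledTree.Segmentation.exists_card_le M ∅ T A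
  have hfam : restrictFamily (definableFamily φ (LabelledTree.Node T)) A =
      Set.range fun q : Y → LabelledTree.Node T =>
        {p | φ.Holds (LabelledTree.Node T) p q} ∩ {p | ∀ x, p x ∈ A} := by
    ext R
    simp [restrictFamily, definableFamily, eq_comm]
  rw [hfam]
  refine (Set.encard_range_le_of_factorsThrough (g := S.code) fun q q' h => ?_).trans ?_
  · ext p
    refine and_congr_left fun hp => ?_
    simp only [Set.mem_ofPred_eq, hF]
    -- The marks of an object tuple in `A` are empty outside `A`.
    rw [S.eval_eq_of_fullType_eq (S.fullType_eq_of_code_eq h) fun t ht => ?_]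
    refine Set.eq_empty_iff_forall_notMem.2 ?_
    rintro x rfl
    exact ht (hp x)
  · have hpos := hA.ncard_pos
    rw [← (Set.toFinite A).cast_ncard_eq]
    norm_cast
    rw [Fintype.card_fun, Fintype.card_prod, Fintype.card_option, ← mul_pow, mul_right_comm]
    gcongr
    omega
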